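/- Let $L_1\le \mathrm{Sym}(\Omega_1)$ and $L_2\le\mathrm{Sym}(\Omega_2)$ be nontrivial transitive permutation groups on finite sets. Call a permutation group semiregular if the identity is its only element fixing a point, and semiprimitive if each of its normal subgroups is transitive or semiregular. Suppose that at least one of $L_1$, $L_2$ is not semiprimitive. Let $\mathfrak T$ be the bi-regular tree with valencies $|\Omega_1|$ and $|\Omega_2|$, that is, the tree (unique up to isomorphism) in which, for some bipartition of the vertex set, every vertex of one part has exactly $|\Omega_1|$ neighbours and every vertex of the other part has exactly $|\Omega_2|$ neighbours. For a group $G$ of automorphisms of $\mathfrak T$ and a vertex $v$, let $G_v$ be the stabiliser of $v$ in $G$, let $\mathfrak T(v)$ be the set of neighbours of $v$, let $G_v^{\mathfrak T(v)}$ be the permutation group induced by $G_v$ on $\mathfrak T(v)$, and let $G_{uv}=G_u\cap G_v$. Then, for every integer $c$, there exists a group $G$ of automorphisms of $\mathfrak T$ such that 1. $(\mathfrak T,G)$ is locally $[L_1,L_2]$, that is, $G_v^{\mathfrak T(v)}$ is transitive for every vertex $v$ of $\mathfrak T$ and, for some edge $\{u,v\}$ of $\mathfrak T$, there are permutation isomorphisms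 $G_u^{\mathfrak T(u)}\cong L_1$ and $G_v^{\mathfrak T(v)}\cong L_2$; and 2. $c\le |G_{uv}|<\infty$ for some edge $\{u,v\}$ of $\mathfrak T$. -/

import Mathlib

/-- A permutation group `K` on `Ω` is semiregular if the identity is the only element of `K`
fixing a point. -/
def IsSemiregularPerm {Ω : Type*} (K : Subgroup (Equiv.Perm Ω)) : Prop :=
  ∀ g ∈ K, ∀ ω : Ω, g ω = ω → g = 1

/-- A permutation group `K` on `Ω` is transitive. -/
def IsTransitivePerm {Ω : Type*} (K : Subgroup (Equiv.Perm Ω)) : Prop :=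
  MulAction.IsPretransitive K Ω

/-- A permutation group `L` is semiprimitive if each of its normal subgroups is transitive or
semiregular.  (A normal subgroup `K` of `L` is viewed as a permutation group on `Ω`.) -/
def IsSemiprimitivePerm {Ω : Type*} (L : Subgroup (Equiv.Perm Ω)) : Prop :=
  ∀ K : Subgroup L, K.Normal →
    IsTransitivePerm (K.map L.subtype) ∨ IsSemiregularPerm (K.map L.subtype)

/-- Permutation isomorphism: a bijection of the underlying sets together with a compatible
isomorphism of groups. -/
def PermIsomorphic {Ω Ω' : Type*} (L : Subgroup (Equiv.Perm Ω))
    (M : Subgroup (Equiv.Perm Ω')) : Prop :=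
  ∃ (e : Ω ≃ Ω') (φ : L ≃* M), ∀ (g : L) (ω : Ω),
    e ((g : Equiv.Perm Ω) ω) = (φ g : Equiv.Perm Ω') (e ω)

namespace SimpleGraph

variable {V : Type*} {Γ : SimpleGraph V}

/-- The stabiliser `G_v` of a vertex `v` in a group `G` of automorphisms of a graph. -/
def vertexStab (G : Subgroup (Γ ≃g Γ)) (v : V) : Subgroup (Γ ≃g Γ) where
  carrier := {g | g ∈ G ∧ g v = v}
  one_mem' := ⟨G.one_mem, rfl⟩
  mul_mem' {a b} ha hb := ⟨G.mul_mem ha.1 hb.1, by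
    rw [RelIso.mul_apply, hb.2, ha.2]⟩
  inv_mem' {a} ha := ⟨G.inv_mem ha.1, by
    conv_lhs => rw [← ha.2]
    exact RelIso.inv_apply_self a v⟩

/-- The action of `G_v` on the neighbourhood `Γ(v)`. -/
def localHom (G : Subgroup (Γ ≃g Γ)) (v : V) :
    vertexStab G v →* Equiv.Perm (Γ.neighborSet v) where
  toFun g := (g : Γ ≃g Γ).toEquiv.subtypeEquiv (fun w => by
    have h : (g : Γ ≃g Γ) v = v := g.2.2
    have h' := (g : Γ ≃g Γ).map_adj_iff (v := v) (w := w)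
    rw [h] at h'
    exact h'.symm)
  map_one' := by ext w; rfl
  map_mul' a b := by ext w; rfl

/-- The permutation group `G_v^{Γ(v)}` induced by `G_v` on `Γ(v)`. -/
def localGroup (G : Subgroup (Γ ≃g Γ)) (v : V) : Subgroup (Equiv.Perm (Γ.neighborSet v)) :=
  (localHom G v).range

/-- `Γ` is `G`-locally-transitive. -/
def IsLocallyTransitive (G : Subgroup (Γ ≃g Γ)) : Prop :=
  ∀ v : V, IsTransitivePerm (localGroup G v)

/-- `(Γ, G)` is locally `[L₁, L₂]`: `Γ` is `G`-locally-transitive and, for some edge `{u, v}`,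
the permutation groups induced by `G_u` and `G_v` on the neighbourhoods of `u` and `v` are
permutation isomorphic to `L₁` and `L₂` respectively. -/
def IsLocally {Ω₁ Ω₂ : Type*} (G : Subgroup (Γ ≃g Γ))
    (L₁ : Subgroup (Equiv.Perm Ω₁)) (L₂ : Subgroup (Equiv.Perm Ω₂)) : Prop :=
  IsLocallyTransitive G ∧
    ∃ u v : V, Γ.Adj u v ∧
      PermIsomorphic (localGroup G u) L₁ ∧ PermIsomorphic (localGroup G v) L₂

/-- The graph is bi-regular with valencies `d₁` and `d₂`: there is a bipartition (into `A` and its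
complement) such that every vertex of `A` has exactly `d₁` neighbours and every other vertex has
exactly `d₂` neighbours. -/
def IsBiregular (Γ : SimpleGraph V) (d₁ d₂ : ℕ) : Prop :=
  ∃ A : Set V, Γ.IsBipartiteWith A Aᶜ ∧
    (∀ v ∈ A, (Γ.neighborSet v).encard = d₁) ∧ (∀ v ∉ A, (Γ.neighborSet v).encard = d₂)

end SimpleGraph

/-!
The group is obtained from an amalgam of two finite groups `A`, `B` inside a finite group `H`.  If
`A` induces `L₁` on `A / (A ⊓ B)`, `B` induces `L₂` on `B / (A ⊓ B)`, and no nontrivial subgroup of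
`A ⊓ B` is normalised by both `A` and `B`, then the tree covers the coset graph of `A` and `B` in
`H`, and the lifts of `H` along this covering form a group which is locally `[L₁, L₂]` and has edge
stabiliser isomorphic to `A ⊓ B` (`SimpleGraph.IsTree.exists_isLocally_of_amalgam`).  Existence of
the covering and of the lifts both come from extending local data along the tree
(`SimpleGraph.IsTree.exists_map_of_local`).

It remains to find such amalgams with `A ⊓ B` arbitrarily large, when `L = L₁`, acting on `Ω`, has a
normal subgroup `K` which is neither transitive nor semiregular; write `M = L₂`, acting on `Ψ`.  Let
`Δ` be the set of `K`-orbits, `d₀` the orbit of a point fixed by some nontrivial `k ∈ K`, and choose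
a representative `o d` of each orbit `d`, that of `d₀` being the given fixed point of `k`.  Elements
of `H` carry a coefficient in `Perm Ω` at each position of a finite set `I` with a base position,
where `I` is coloured by `Δ`.  In both groups all coefficients lie in `L` and induce one permutation
`b` of `Δ`, and the coefficient at a position of colour `d` maps `o d` to `o (b d)`.  In `A` the
base position is fixed and its coefficient is exempt from the last condition, so that this
coefficient can be any element of `L`; in `B` the base position may be moved by `M`, while `b` fixes
`d₀`.  Therefore `A` induces `L`, `B` induces `M`, and `A ⊓ B` contains a copy of `⟨k⟩` for each
position of colour `d₀`.  For faithfulness (`Positions.eq_bot_of_normalized`) the actions of `A` and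
`B` have to connect all positions while agreeing on `A ⊓ B`; this is where the intransitivity of `K`
is used (`exists_positions`).
-/

/-! ### Extending local data over a tree -/

namespace SimpleGraph

section Develop

variable {V W α : Type*} {T : SimpleGraph V}

/-- The value obtained by transporting `a`, placed at the end of a walk, back to the start of the
walk: each step from `y` to its predecessor `x` applies `F y x`. -/
def Walk.develop (F : V → V → α → α) (a : α) : ∀ {x r : V}, T.Walk x r → α
  | _, _, .nil => a
  | _, _, .cons (u := x) (v := y) _ w => F y x (w.develop F a)

/-- In a tree, the paths from two neighbours to a common vertex differ by the edge joining these
neighbours. -/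
theorem IsTree.path_eq_cons_or_path_eq_cons (hT : T.IsTree) {x y r : V} (h : T.Adj x y)
    (p : T.Walk x r) (q : T.Walk y r) (hp : p.IsPath) (hq : q.IsPath) :
    p = .cons h q ∨ q = .cons h.symm p := by
  classical
  have uniq : ∀ {a b : V} (p q : T.Walk a b), p.IsPath → q.IsPath → p = q := by
    intro a b p q hp hq
    have := hT.isAcyclic.subsingleton_path a b
    exact congrArg Subtype.val (Subsingleton.elim (⟨p, hp⟩ : T.Path a b) ⟨q, hq⟩)
  by_cases hx : x ∈ q.support
  · right
    have h1 : q.dropUntil x hx = p := uniq _ _ (hq.dropUntil hx) hp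
    have h2 : q.takeUntil x hx = .cons h.symm .nil := by
      refine uniq _ _ (hq.takeUntil hx) ?_
      rw [Walk.cons_isPath_iff]
      exact ⟨Walk.IsPath.nil, by simpa using h.ne'⟩
    rw [← q.take_spec hx, h1, h2]
    rfl
  · left
    exact uniq _ _ hp ((Walk.cons_isPath_iff h q).2 ⟨hq, hx⟩)

/-- To define a map on a tree, it is enough to define it on the star of a root, and to know how to
extend it from the star of a vertex to the star of a neighbour.  Here `Good x m` says that the map
`m` is acceptable on the star of `x`; it may depend only on the restriction of `m` to that star. -/
theorem IsTree.exists_map_of_local (hT : T.IsTree) (r : V) (Good : V → (V → W) → Prop)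
    (hcongr : ∀ x m m', m x = m' x → (∀ y, T.Adj x y → m y = m' y) → Good x m → Good x m')
    (m₀ : V → W) (h₀ : Good r m₀)
    (step : ∀ x y m, T.Adj x y → Good x m → ∃ m', Good y m' ∧ m' x = m x ∧ m' y = m y) :
    ∃ p : V → W, p r = m₀ r ∧ ∀ x, Good x p := by
  classical
  have step' : ∀ x y m, ∃ m', T.Adj x y → Good x m → Good y m' ∧ m' x = m x ∧ m' y = m y := by
    intro x y m
    by_cases h : T.Adj x y ∧ Good x m
    · obtain ⟨m', hm'⟩ := step x y m h.1 h.2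
      exact ⟨m', fun _ _ => hm'⟩
    · exact ⟨m, fun h1 h2 => (h ⟨h1, h2⟩).elim⟩
  choose F hF using step'
  have hgood : ∀ {x s : V} (w : T.Walk x s), s = r → Good x (w.develop F m₀) := by
    intro x s w hs
    induction w with
    | nil => subst hs; exact h₀
    | cons h w ih => exact (hF _ _ _ h.symm (ih hs)).1
  choose path hpath _ using fun x => hT.existsUnique_path x r
  set m : V → V → W := fun x => (path x).develop F m₀ with hm
  have hstar : ∀ x y, T.Adj x y → m x y = m y y := by
    intro x y h
    rcases hT.path_eq_cons_or_path_eq_cons h _ _ (hpath x) (hpath y) with e | e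
    · simp only [hm]
      rw [e]
      exact (hF _ _ _ h.symm (hgood (path y) rfl)).2.1
    · simp only [hm]
      rw [e]
      exact (hF _ _ _ h (hgood (path x) rfl)).2.2.symm
  refine ⟨fun x => m x x, ?_, fun x => ?_⟩
  · have : path r = .nil := by
      simpa using (hpath r)
    simp only [hm, this]
    rfl
  · exact hcongr x (m x) _ rfl (fun y h => hstar x y h) (hgood (path x) rfl)

end Develop

/-! ### Coverings of graphs by trees -/

section Covering

variable {V V' W : Type*} {T : SimpleGraph V} {T' : SimpleGraph V'} {Γ : SimpleGraph W}

/-- A covering of graphs: a map which is bijective from the neighbours of each vertex to the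
neighbours of its image.  Surjectivity on vertices is not required. -/
def IsCovering (T : SimpleGraph V) (Γ : SimpleGraph W) (p : V → W) : Prop :=
  ∀ x, Set.BijOn p (T.neighborSet x) (Γ.neighborSet (p x))

theorem IsCovering.adj {p : V → W} (hp : IsCovering T Γ p) {x y : V} (h : T.Adj x y) :
    Γ.Adj (p x) (p y) :=
  (hp x).mapsTo h

theorem IsCovering.eq_of_adj {p : V → W} (hp : IsCovering T Γ p) {x y z : V} (hy : T.Adj x y)
    (hz : T.Adj x z) (h : p y = p z) : y = z :=
  (hp x).injOn hy hz h

theorem IsCovering.exists_adj {p : V → W} (hp : IsCovering T Γ p) {x : V} {b : W}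
    (h : Γ.Adj (p x) b) : ∃ y, T.Adj x y ∧ p y = b :=
  (hp x).surjOn h

/-- A tree covers every graph having the same local structure, where `R x a` says that `x` and `a`
have the same type. -/
theorem IsTree.exists_isCovering (hT : T.IsTree) (R : V → W → Prop)
    (hfin : ∀ x a, R x a → (T.neighborSet x).Finite)
    (hcard : ∀ x a, R x a → (T.neighborSet x).encard = (Γ.neighborSet a).encard)
    (hadj : ∀ x y a b, R x a → T.Adj x y → Γ.Adj a b → R y b)
    (r : V) (a : W) (hra : R r a) : ∃ p, IsCovering T Γ p ∧ p r = a ∧ ∀ x, R x (p x) := by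
  classical
  have : Nonempty W := ⟨a⟩
  obtain ⟨p, hpr, hp⟩ := hT.exists_map_of_local (W := W) r
    (fun x m => R x (m x) ∧ Set.BijOn m (T.neighborSet x) (Γ.neighborSet (m x)))
    (by
      rintro x m m' h1 h2 ⟨h3, h4⟩
      rw [h1] at h3 h4
      exact ⟨h3, h4.congr h2⟩)
    (Function.update
      ((hfin r a hra).exists_bijOn_of_encard_eq (hcard r a hra)).choose r a)
    (by
      have hf := ((hfin r a hra).exists_bijOn_of_encard_eq (hcard r a hra)).choose_spec
      set f := ((hfin r a hra).exists_bijOn_of_encard_eq (hcard r a hra)).choose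
      simp only [Function.update_self]
      refine ⟨hra, hf.congr fun y hy => ?_⟩
      rw [Function.update_of_ne (T.ne_of_adj hy).symm])
    (by
      rintro x y m hxy ⟨hR, hm⟩
      have hΓ : Γ.Adj (m x) (m y) := hm.mapsTo hxy
      have hR' := hadj _ _ _ _ hR hxy hΓ
      obtain ⟨f, hf⟩ := (hfin _ _ hR').exists_bijOn_of_encard_eq (hcard _ _ hR')
      -- an arbitrary bijection between the neighbourhoods is corrected by a transposition, so
      -- that the value at `x` is the given one
      have hs : Set.BijOn (Equiv.swap (f x) (m x)) (Γ.neighborSet (m y))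
          (Γ.neighborSet (m y)) := by
        have hmaps : Set.MapsTo (Equiv.swap (f x) (m x)) (Γ.neighborSet (m y))
            (Γ.neighborSet (m y)) := by
          intro z hz
          by_cases h1 : z = f x
          · rw [h1, Equiv.swap_apply_left]; exact hΓ.symm
          by_cases h2 : z = m x
          · rw [h2, Equiv.swap_apply_right]; exact hf.mapsTo hxy.symm
          rwa [Equiv.swap_apply_of_ne_of_ne h1 h2]
        exact ⟨hmaps, (Equiv.injective _).injOn, fun z hz =>
          ⟨_, hmaps hz, Equiv.swap_apply_self _ _ _⟩⟩
      refine ⟨Function.update (Equiv.swap (f x) (m x) ∘ f) y (m y), ⟨?_, ?_⟩, ?_, ?_⟩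
      · simpa using hR'
      · rw [Function.update_self]
        refine (hs.comp hf).congr fun z hz => ?_
        rw [Function.update_of_ne (T.ne_of_adj hz).symm]
      · rw [Function.update_of_ne (T.ne_of_adj hxy)]
        simp
      · simp)
  refine ⟨p, fun x => (hp x).2, ?_, fun x => (hp x).1⟩
  rw [hpr, Function.update_self]

/-- Morphisms from a tree lift through coverings. -/
theorem IsTree.exists_lift (hT : T.IsTree) {f : V → W} {q : V' → W}
    (hf : ∀ x y, T.Adj x y → Γ.Adj (f x) (f y)) (hq : IsCovering T' Γ q) (r : V) (r' : V')
    (h : q r' = f r) :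
    ∃ g : V → V', g r = r' ∧ (∀ x, q (g x) = f x) ∧ ∀ x y, T.Adj x y → T'.Adj (g x) (g y) := by
  classical
  have key : ∀ y v, q v = f y → ∃ m : V → V', m y = v ∧
      ∀ z, T.Adj y z → T'.Adj v (m z) ∧ q (m z) = f z := by
    intro y v hv
    have : ∀ z, ∃ w, (y = z → w = v) ∧ (T.Adj y z → T'.Adj v w ∧ q w = f z) := by
      intro z
      by_cases hz : T.Adj y z
      · obtain ⟨w, hw⟩ := hq.exists_adj (x := v) (b := f z) (by rw [hv]; exact hf _ _ hz)
        exact ⟨w, fun e => (T.ne_of_adj hz e).elim, fun _ => hw⟩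
      · exact ⟨v, fun _ => rfl, fun h => (hz h).elim⟩
    choose m h1 h2 using this
    exact ⟨m, h1 y rfl, h2⟩
  obtain ⟨m₀, hm₀, hm₀'⟩ := key r r' h
  obtain ⟨g, hgr, hg⟩ := hT.exists_map_of_local (W := V') r
    (fun x m => q (m x) = f x ∧ ∀ z, T.Adj x z → T'.Adj (m x) (m z) ∧ q (m z) = f z)
    (by
      rintro x m m' h1 h2 ⟨h3, h4⟩
      refine ⟨h1 ▸ h3, fun z hz => ?_⟩
      rw [← h1, ← h2 z hz]
      exact h4 z hz)
    m₀ ⟨hm₀ ▸ h, hm₀ ▸ hm₀'⟩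
    (by
      rintro x y m hxy ⟨h1, h2⟩
      obtain ⟨m', hy, hm'⟩ := key y (m y) (h2 y hxy).2
      refine ⟨m', ⟨hy ▸ (h2 y hxy).2, hy ▸ hm'⟩, ?_, hy⟩
      exact hq.eq_of_adj (hm' x hxy.symm).1 (h2 y hxy).1.symm ((hm' x hxy.symm).2.trans h1.symm))
  exact ⟨g, hgr.trans hm₀, fun x => (hg x).1, fun x y hxy => ((hg x).2 y hxy).1⟩

/-- Two morphisms from a connected graph with the same composition with a covering agree as soon
as they agree at one vertex. -/
theorem IsCovering.lift_unique (hT : T.Connected) {q : V' → W} (hq : IsCovering T' Γ q)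
    {g g' : V → V'} (hg : ∀ x y, T.Adj x y → T'.Adj (g x) (g y))
    (hg' : ∀ x y, T.Adj x y → T'.Adj (g' x) (g' y)) (h : ∀ x, q (g x) = q (g' x)) (r : V)
    (hr : g r = g' r) : g = g' := by
  funext x
  obtain ⟨w⟩ := hT.preconnected r x
  induction w with
  | nil => exact hr
  | cons e _ ih =>
    exact ih (hq.eq_of_adj (hg _ _ e) (by rw [hr]; exact hg' _ _ e) (h _))

end Covering

/-! ### Lifting a group along a covering -/

section Deck

variable {V W H : Type*} [Group H] [MulAction H W] {T : SimpleGraph V} {Γ : SimpleGraph W}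

/-- The group of all automorphisms of `T` which lift, along the map `p`, the action on `Γ` of some
element of `H`. -/
def liftedGroup (H : Type*) [Group H] [MulAction H W] (T : SimpleGraph V) (p : V → W) :
    Subgroup (T ≃g T) where
  carrier := {g | ∃ h : H, ∀ x, p (g x) = h • p x}
  one_mem' := ⟨1, fun x => by simp⟩
  mul_mem' := by
    rintro a b ⟨h, hh⟩ ⟨k, hk⟩
    exact ⟨h * k, fun x => by rw [RelIso.mul_apply, hh, hk, mul_smul]⟩
  inv_mem' := by
    rintro a ⟨h, hh⟩
    refine ⟨h⁻¹, fun x => ?_⟩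
    rw [eq_inv_smul_iff, ← hh, RelIso.apply_inv_self]

variable {p : V → W}

theorem mem_liftedGroup {g : T ≃g T} :
    g ∈ liftedGroup H T p ↔ ∃ h : H, ∀ x, p (g x) = h • p x :=
  Iff.rfl

/-- The action of each `h : H` lifts to the covering tree, with a prescribed image of one vertex. -/
theorem IsTree.exists_lift_smul (hT : T.IsTree)
    (hΓ : ∀ (h : H) (a b : W), Γ.Adj a b → Γ.Adj (h • a) (h • b)) (hp : IsCovering T Γ p)
    (h : H) (x x' : V) (hx : p x' = h • p x) :
    ∃ g : T ≃g T, g x = x' ∧ ∀ y, p (g y) = h • p y := by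
  obtain ⟨g, hg1, hg2, hg3⟩ := hT.exists_lift (f := fun y => h • p y)
    (fun a b hab => hΓ h _ _ (hp.adj hab)) hp x x' hx
  obtain ⟨g', hg1', hg2', hg3'⟩ := hT.exists_lift (f := fun y => h⁻¹ • p y)
    (fun a b hab => hΓ h⁻¹ _ _ (hp.adj hab)) hp x' x (by rw [hx, inv_smul_smul])
  have e1 : g' ∘ g = id := hp.lift_unique hT.1 (fun a b hab => hg3' _ _ (hg3 _ _ hab))
    (fun _ _ hab => hab) (fun y => by simp [hg2, hg2']) x (by simp [hg1, hg1'])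
  have e2 : g ∘ g' = id := hp.lift_unique hT.1 (fun a b hab => hg3 _ _ (hg3' _ _ hab))
    (fun _ _ hab => hab) (fun y => by simp [hg2, hg2']) x' (by simp [hg1, hg1'])
  refine ⟨⟨⟨g, g', congrFun e1, congrFun e2⟩, ?_⟩, hg1, hg2⟩
  intro a b
  refine ⟨fun hab => ?_, fun hab => hg3 _ _ hab⟩
  have := hg3' _ _ hab
  simpa using (congrFun e1 a ▸ congrFun e1 b ▸ this : T.Adj (id a) (id b))

/-- A bijection conjugating one permutation group to another is a permutation isomorphism. -/
theorem _root_.PermIsomorphic.of_forall {Ω Ω' : Type*} {L : Subgroup (Equiv.Perm Ω)}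
    {M : Subgroup (Equiv.Perm Ω')} (e : Ω ≃ Ω')
    (h₁ : ∀ g ∈ L, ∃ l ∈ M, ∀ ω, e (g ω) = l (e ω))
    (h₂ : ∀ l ∈ M, ∃ g ∈ L, ∀ ω, e (g ω) = l (e ω)) : PermIsomorphic L M := by
  have hL : L.map e.permCongrHom.toMonoidHom = M := by
    ext l
    simp only [Subgroup.mem_map]
    constructor
    · rintro ⟨g, hg, rfl⟩
      obtain ⟨l, hl, hgl⟩ := h₁ g hg
      convert hl
      ext ω
      simpa using hgl (e.symm ω)
    · intro hl
      obtain ⟨g, hg, hgl⟩ := h₂ l hl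
      refine ⟨g, hg, ?_⟩
      ext ω
      simpa using hgl (e.symm ω)
  refine ⟨e, (L.equivMapOfInjective e.permCongrHom.toMonoidHom e.permCongrHom.injective).trans
    (MulEquiv.subgroupCongr hL), fun g ω => ?_⟩
  change e ((g : Equiv.Perm Ω) ω) = e.permCongr g (e ω)
  simp

/-- The local group of the lifted group at `x` is the group induced by the stabiliser of `p x` in
`H` on the neighbours of `p x`; here the latter is identified with `L` by a labelling `E`. -/
theorem permIsomorphic_localGroup_liftedGroup (hT : T.IsTree)
    (hΓ : ∀ (h : H) (a b : W), Γ.Adj a b → Γ.Adj (h • a) (h • b)) (hp : IsCovering T Γ p)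
    {Ω : Type*} {L : Subgroup (Equiv.Perm Ω)} (x : V) (E : W → Ω)
    (hE : Set.BijOn E (Γ.neighborSet (p x)) Set.univ)
    (h₁ : ∀ h : H, h • p x = p x → ∃ l ∈ L, ∀ b, Γ.Adj (p x) b → E (h • b) = l (E b))
    (h₂ : ∀ l ∈ L, ∃ h : H, h • p x = p x ∧ ∀ b, Γ.Adj (p x) b → E (h • b) = l (E b)) :
    PermIsomorphic (localGroup (liftedGroup H T p) x) L := by
  have hb := hE.comp (hp x)
  let e : T.neighborSet x ≃ Ω := Equiv.ofBijective (fun y => E (p y)) (by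
    refine ⟨fun y z hyz => Subtype.ext (hb.injOn y.2 z.2 hyz), fun ω => ?_⟩
    obtain ⟨y, hy, hyω⟩ := hb.surjOn (Set.mem_univ ω)
    exact ⟨⟨y, hy⟩, hyω⟩)
  refine PermIsomorphic.of_forall e ?_ ?_
  · rintro _ ⟨⟨g, hgG, hgx⟩, rfl⟩
    obtain ⟨h, hh⟩ := mem_liftedGroup.1 hgG
    obtain ⟨l, hl, hlE⟩ := h₁ h (by rw [← hh, hgx])
    refine ⟨l, hl, fun y => ?_⟩
    change E (p (g y)) = l (E (p y))
    rw [← hlE _ (hp.adj y.2), ← hh]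
  · intro l hl
    obtain ⟨h, hhx, hlE⟩ := h₂ l hl
    obtain ⟨g, hgx, hg⟩ := hT.exists_lift_smul hΓ hp h x x hhx.symm
    refine ⟨localHom _ x ⟨g, mem_liftedGroup.2 ⟨h, hg⟩, hgx⟩, ⟨_, rfl⟩, fun y => ?_⟩
    change E (p (g y)) = l (E (p y))
    rw [← hlE _ (hp.adj y.2), ← hg]

theorem isTransitivePerm_localGroup_liftedGroup (hT : T.IsTree)
    (hΓ : ∀ (h : H) (a b : W), Γ.Adj a b → Γ.Adj (h • a) (h • b)) (hp : IsCovering T Γ p)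
    (x : V) (htr : ∀ b b', Γ.Adj (p x) b → Γ.Adj (p x) b' → ∃ h : H, h • p x = p x ∧ h • b = b') :
    IsTransitivePerm (localGroup (liftedGroup H T p) x) := by
  refine ⟨fun y z => ?_⟩
  obtain ⟨h, hhx, hh⟩ := htr _ _ (hp.adj y.2) (hp.adj z.2)
  obtain ⟨g, hgx, hg⟩ := hT.exists_lift_smul hΓ hp h x x hhx.symm
  refine ⟨⟨localHom _ x ⟨g, mem_liftedGroup.2 ⟨h, hg⟩, hgx⟩, ⟨_, rfl⟩⟩, Subtype.ext ?_⟩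
  refine hp.eq_of_adj (x := x) ?_ z.2 ((hg _).trans hh)
  have := g.map_adj_iff.2 y.2
  rwa [hgx] at this

end Deck

end SimpleGraph

/-! ### Coset graphs of amalgams -/

namespace SimpleGraph

section CosetGraph

variable {H : Type*} [Group H] {S : Bool → Subgroup H}

/-- The coset graph of a pair of subgroups `S true`, `S false` of `H`: the vertices are the left
cosets of both subgroups, and two cosets of different subgroups are adjacent when they meet. -/
def cosetGraph (S : Bool → Subgroup H) : SimpleGraph (Σ i, H ⧸ S i) where
  Adj x y := x.1 ≠ y.1 ∧ ∃ h : H, x.2 = (h : H ⧸ S x.1) ∧ y.2 = (h : H ⧸ S y.1)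
  symm := ⟨by
    rintro x y ⟨h1, h, h2, h3⟩
    exact ⟨h1.symm, h, h3, h2⟩⟩
  loopless := ⟨fun x h => h.1 rfl⟩

theorem cosetGraph_adj_iff {i : Bool} {x : H ⧸ S i} {b : Σ i, H ⧸ S i} :
    (cosetGraph S).Adj ⟨i, x⟩ b ↔
      ∃ h : H, x = (h : H ⧸ S i) ∧ b = ⟨!i, (h : H ⧸ S (!i))⟩ := by
  obtain ⟨j, y⟩ := b
  constructor
  · rintro ⟨hij, h, hx, hy⟩
    obtain rfl : j = !i := Bool.eq_not.2 (Ne.symm hij)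
    exact ⟨h, hx, by rw [← hy]⟩
  · rintro ⟨h, hx, hb⟩
    cases hb
    exact ⟨by simp, h, hx, rfl⟩

theorem cosetGraph_adj_smul (h : H) (a b : Σ i, H ⧸ S i) (hab : (cosetGraph S).Adj a b) :
    (cosetGraph S).Adj (h • a) (h • b) := by
  obtain ⟨hne, k, ha, hb⟩ := hab
  refine ⟨hne, h * k, ?_, ?_⟩
  · change h • a.2 = _
    rw [ha]; rfl
  · change h • b.2 = _
    rw [hb]; rfl

theorem cosetGraph_stabilizer_transitive (a b b' : Σ i, H ⧸ S i) (hb : (cosetGraph S).Adj a b)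
    (hb' : (cosetGraph S).Adj a b') : ∃ h : H, h • a = a ∧ h • b = b' := by
  obtain ⟨i, x⟩ := a
  obtain ⟨g, hg, rfl⟩ := cosetGraph_adj_iff.1 hb
  obtain ⟨g', hg', rfl⟩ := cosetGraph_adj_iff.1 hb'
  have key : ∀ j, (g' * g⁻¹) • (g : H ⧸ S j) = (g' : H ⧸ S j) := by
    intro j
    rw [MulAction.Quotient.smul_coe, smul_eq_mul, inv_mul_cancel_right]
  refine ⟨g' * g⁻¹, ?_, ?_⟩
  · change (⟨i, (g' * g⁻¹) • x⟩ : Σ i, H ⧸ S i) = ⟨i, x⟩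
    conv_lhs => rw [hg, key i, ← hg']
  · change (⟨!i, (g' * g⁻¹) • (g : H ⧸ S (!i))⟩ : Σ i, H ⧸ S i) = _
    rw [key]

theorem smul_cosetGraph_base {i : Bool} {h : H} :
    h • (⟨i, ((1 : H) : H ⧸ S i)⟩ : Σ i, H ⧸ S i) = ⟨i, ((1 : H) : H ⧸ S i)⟩ ↔ h ∈ S i := by
  change (⟨i, h • ((1 : H) : H ⧸ S i)⟩ : Σ i, H ⧸ S i) = _ ↔ _
  rw [MulAction.Quotient.smul_coe, smul_eq_mul, mul_one, Sigma.mk.injEq]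
  simp only [heq_eq_eq, true_and]
  rw [eq_comm, QuotientGroup.eq]
  simp

/-- The action of `S i` on the cosets of `S true ⊓ S false` is the permutation group `L`: there is
a homomorphism from `S i` onto `L` for which the stabiliser of some point is
`S true ⊓ S false`. -/
def InducesOnCosets {Ω : Type*} (S : Bool → Subgroup H) (i : Bool)
    (L : Subgroup (Equiv.Perm Ω)) : Prop :=
  ∃ (ρ : S i →* Equiv.Perm Ω) (ω : Ω), ρ.range = L ∧ ∀ a : S i, ρ a ω = ω ↔ (a : H) ∈ S (!i)

theorem cosetGraph_adj_base_iff {i : Bool} {b : Σ i, H ⧸ S i} :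
    (cosetGraph S).Adj ⟨i, ((1 : H) : H ⧸ S i)⟩ b ↔
      ∃ a : S i, b = ⟨!i, ((a : H) : H ⧸ S (!i))⟩ := by
  rw [cosetGraph_adj_iff]
  constructor
  · rintro ⟨h, h1, h2⟩
    rw [QuotientGroup.eq] at h1
    exact ⟨⟨h, by simpa using h1⟩, h2⟩
  · rintro ⟨a, h2⟩
    refine ⟨a, ?_, h2⟩
    rw [QuotientGroup.eq]
    simp

/-- The neighbours of the base vertex of type `i` in the coset graph are labelled by `Ω`, in such
a way that the stabiliser `S i` of that vertex induces `L`. -/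
theorem InducesOnCosets.exists_label {Ω : Type*} {i : Bool} {L : Subgroup (Equiv.Perm Ω)}
    (hL : InducesOnCosets S i L) (ht : IsTransitivePerm L) :
    ∃ E : (Σ i, H ⧸ S i) → Ω,
      Set.BijOn E ((cosetGraph S).neighborSet ⟨i, ((1 : H) : H ⧸ S i)⟩) Set.univ ∧
      (∀ h ∈ S i, ∃ l ∈ L, ∀ b, (cosetGraph S).Adj ⟨i, ((1 : H) : H ⧸ S i)⟩ b →
        E (h • b) = l (E b)) ∧
      ∀ l ∈ L, ∃ h ∈ S i, ∀ b, (cosetGraph S).Adj ⟨i, ((1 : H) : H ⧸ S i)⟩ b →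
        E (h • b) = l (E b) := by
  classical
  obtain ⟨ρ, ω, hρ, hω⟩ := hL
  have hwd : ∀ a a' : S i, ((a : H) : H ⧸ S (!i)) = ((a' : H) : H ⧸ S (!i)) ↔
      ρ a ω = ρ a' ω := by
    intro a a'
    rw [QuotientGroup.eq]
    have := hω (a⁻¹ * a')
    rw [map_mul, map_inv, Equiv.Perm.mul_apply, Equiv.Perm.inv_eq_iff_eq] at this
    rw [eq_comm (a := ρ a ω), this]
    rfl
  let E : (Σ i, H ⧸ S i) → Ω := fun b =>
    if h : ∃ a : S i, b = ⟨!i, ((a : H) : H ⧸ S (!i))⟩ then ρ h.choose ω else ω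
  have hE : ∀ a : S i, E ⟨!i, ((a : H) : H ⧸ S (!i))⟩ = ρ a ω := by
    intro a
    have h : ∃ a' : S i, (⟨!i, ((a : H) : H ⧸ S (!i))⟩ : Σ i, H ⧸ S i) =
      ⟨!i, ((a' : H) : H ⧸ S (!i))⟩ := ⟨a, rfl⟩
    simp only [E]
    rw [dif_pos h, ← hwd]
    have := h.choose_spec
    rw [Sigma.mk.injEq] at this
    exact (eq_of_heq this.2).symm
  have hsmul : ∀ (h : S i) (a : S i), (h : H) • (⟨!i, ((a : H) : H ⧸ S (!i))⟩ : Σ i, H ⧸ S i) =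
      ⟨!i, (((h * a : S i) : H) : H ⧸ S (!i))⟩ := fun h a => rfl
  refine ⟨E, ⟨fun _ _ => Set.mem_univ _, ?_, ?_⟩, ?_, ?_⟩
  · intro b hb b' hb' hbb
    obtain ⟨a, rfl⟩ := cosetGraph_adj_base_iff.1 hb
    obtain ⟨a', rfl⟩ := cosetGraph_adj_base_iff.1 hb'
    rw [hE, hE, ← hwd] at hbb
    rw [hbb]
  · intro x _
    obtain ⟨⟨l, hl⟩, hlx⟩ := ht.exists_smul_eq ω x
    rw [← hρ] at hl
    obtain ⟨a, rfl⟩ := hl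
    exact ⟨_, cosetGraph_adj_base_iff.2 ⟨a, rfl⟩, (hE a).trans hlx⟩
  · intro h hh
    refine ⟨ρ ⟨h, hh⟩, hρ ▸ ⟨_, rfl⟩, fun b hb => ?_⟩
    obtain ⟨a, rfl⟩ := cosetGraph_adj_base_iff.1 hb
    have := hsmul ⟨h, hh⟩ a
    simp only at this
    rw [this, hE, hE, map_mul, Equiv.Perm.mul_apply]
  · intro l hl
    rw [← hρ] at hl
    obtain ⟨h, rfl⟩ := hl
    refine ⟨h, h.2, fun b hb => ?_⟩
    obtain ⟨a, rfl⟩ := cosetGraph_adj_base_iff.1 hb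
    rw [hsmul, hE, hE, map_mul, Equiv.Perm.mul_apply]

theorem InducesOnCosets.encard_neighborSet {Ω : Type*} [Finite Ω] {i : Bool}
    {L : Subgroup (Equiv.Perm Ω)} (hL : InducesOnCosets S i L) (ht : IsTransitivePerm L)
    (x : H ⧸ S i) : ((cosetGraph S).neighborSet ⟨i, x⟩).encard = Nat.card Ω := by
  obtain ⟨h, rfl⟩ := QuotientGroup.mk_surjective x
  obtain ⟨E, hE, -, -⟩ := hL.exists_label ht
  have h1 : (cosetGraph S).neighborSet ⟨i, (h : H ⧸ S i)⟩ =
      (fun b => h • b) '' (cosetGraph S).neighborSet ⟨i, ((1 : H) : H ⧸ S i)⟩ := by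
    have hh : h • (⟨i, ((1 : H) : H ⧸ S i)⟩ : Σ i, H ⧸ S i) = ⟨i, (h : H ⧸ S i)⟩ := by
      change (⟨i, h • ((1 : H) : H ⧸ S i)⟩ : Σ i, H ⧸ S i) = _
      rw [MulAction.Quotient.smul_coe, smul_eq_mul, mul_one]
    ext b
    constructor
    · intro hb
      refine ⟨h⁻¹ • b, ?_, smul_inv_smul h b⟩
      have := cosetGraph_adj_smul h⁻¹ _ _ hb
      rwa [← hh, inv_smul_smul] at this
    · rintro ⟨b, hb, rfl⟩
      have := cosetGraph_adj_smul h _ _ hb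
      rwa [hh] at this
  rw [h1, (MulAction.injective h).injOn.encard_image, ← hE.injOn.encard_image, hE.image_eq,
    Set.encard_univ, ENat.card_eq_coe_natCard]

end CosetGraph

/-! ### Realising an amalgam on a biregular tree -/

section Realise

variable {H V Ω₁ Ω₂ : Type*} [Group H] {S : Bool → Subgroup H} [Finite Ω₁] [Finite Ω₂]
  {L₁ : Subgroup (Equiv.Perm Ω₁)} {L₂ : Subgroup (Equiv.Perm Ω₂)} {T : SimpleGraph V}

/-- If no nontrivial subgroup of `S true ⊓ S false` is normalised by both `S true` and `S false`,
then the amalgam acts on the biregular tree with edge stabiliser `S true ⊓ S false`. -/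
theorem IsTree.exists_isLocally_of_amalgam (hT : T.IsTree)
    (hreg : T.IsBiregular (Nat.card Ω₁) (Nat.card Ω₂))
    (ht₁ : IsTransitivePerm L₁) (ht₂ : IsTransitivePerm L₂)
    (h₁ : InducesOnCosets S true L₁) (h₂ : InducesOnCosets S false L₂)
    (hcore : ∀ N : Subgroup H, (∀ i, N ≤ S i) → (∀ i, ∀ a ∈ S i, ∀ n ∈ N, a * n * a⁻¹ ∈ N) →
      N = ⊥) :
    ∃ G : Subgroup (T ≃g T), IsLocally G L₁ L₂ ∧ ∃ u v : V, T.Adj u v ∧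
      Nonempty (↥(S true ⊓ S false) ≃ ↥(vertexStab G u ⊓ vertexStab G v)) := by
  classical
  obtain ⟨A, hA, hd₁, hd₂⟩ := hreg
  have hAadj : ∀ x y, T.Adj x y → (x ∈ A ↔ y ∉ A) := by
    intro x y hxy
    rcases hA.mem_of_adj hxy with ⟨h1, h2⟩ | ⟨h1, h2⟩
    · exact ⟨fun _ => h2, fun _ => h1⟩
    · exact ⟨fun h => (h1 h).elim, fun h => (h h2).elim⟩
  have hne : Nonempty Ω₂ := ⟨h₂.choose_spec.choose⟩
  -- both parts of the bipartition are nonempty, as the valencies are positive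
  obtain ⟨u, hu⟩ : ∃ u, u ∈ A := by
    obtain ⟨v⟩ := hT.1.nonempty
    by_cases hv : v ∈ A
    · exact ⟨v, hv⟩
    · have : (T.neighborSet v).Nonempty := by
        rw [← Set.encard_pos, hd₂ v hv]
        exact_mod_cast Nat.card_pos
      obtain ⟨u, hvu⟩ := this
      exact ⟨u, (hAadj _ _ (T.adj_symm hvu)).2 hv⟩
  obtain ⟨p, hp, hpu, -⟩ := hT.exists_isCovering (Γ := cosetGraph S)
    (fun x a => x ∈ A ↔ a.1 = true)
    (by
      intro x a _
      by_cases hx : x ∈ A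
      · exact Set.finite_of_encard_eq_coe (hd₁ x hx)
      · exact Set.finite_of_encard_eq_coe (hd₂ x hx))
    (by
      rintro x ⟨i, a⟩ hxa
      by_cases hx : x ∈ A
      · obtain rfl : i = true := hxa.1 hx
        rw [hd₁ x hx, h₁.encard_neighborSet ht₁]
      · obtain rfl : i = false := Bool.eq_false_iff.2 fun h => hx (hxa.2 h)
        rw [hd₂ x hx, h₂.encard_neighborSet ht₂])
    (by
      rintro x y ⟨i, a⟩ ⟨j, b⟩ hxa hxy hab
      have hij : i ≠ j := hab.1
      have := hAadj x y hxy
      simp only at hxa ⊢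
      cases i <;> cases j <;> simp_all)
    u ⟨true, ((1 : H) : H ⧸ S true)⟩ (by simpa using hu)
  obtain ⟨v, huv, hpv⟩ := hp.exists_adj (x := u) (b := ⟨false, ((1 : H) : H ⧸ S false)⟩)
    (by rw [hpu]; exact cosetGraph_adj_base_iff.2 ⟨1, rfl⟩)
  have hsmul := cosetGraph_adj_smul (S := S)
  have hlift : ∀ (h : H) (x x' : V), p x' = h • p x →
      ∃ g : T ≃g T, g x = x' ∧ ∀ y, p (g y) = h • p y :=
    fun h x x' => hT.exists_lift_smul hsmul hp h x x'
  have hbase : ∀ i, ∃ w, p w = ⟨i, ((1 : H) : H ⧸ S i)⟩ := by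
    rintro (_ | _)
    exacts [⟨v, hpv⟩, ⟨u, hpu⟩]
  -- the elements of `H` acting trivially on the image of the covering form a subgroup of the core
  have hfaith : ∀ h : H, (∀ x, h • p x = p x) → h = 1 := by
    let N : Subgroup H :=
      { carrier := {n | ∀ x, n • p x = p x}
        one_mem' := fun x => one_smul _ _
        mul_mem' := fun {a b} ha hb x => by rw [mul_smul, hb, ha]
        inv_mem' := fun {a} ha x => by rw [inv_smul_eq_iff, ha] }
    have hN : N = ⊥ := by
      refine hcore N (fun i n hn => ?_) (fun i a ha n hn x => ?_)
      · obtain ⟨w, hw⟩ := hbase i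
        have := hn w
        rwa [hw, smul_cosetGraph_base] at this
      · obtain ⟨w, hw⟩ := hbase i
        obtain ⟨g, -, hg⟩ := hlift a⁻¹ w w
          (by rw [hw, smul_cosetGraph_base.2 (inv_mem ha)])
        rw [mul_smul, mul_smul, ← hg, hn, hg, smul_inv_smul]
    intro h hh
    have : h ∈ N := hh
    rwa [hN, Subgroup.mem_bot] at this
  refine ⟨liftedGroup H T p, ⟨fun x => isTransitivePerm_localGroup_liftedGroup hT hsmul hp x
    fun b b' => cosetGraph_stabilizer_transitive _ b b', u, v, huv, ?_, ?_⟩, u, v, huv, ?_⟩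
  · obtain ⟨E, hE, hE₁, hE₂⟩ := h₁.exists_label ht₁
    refine permIsomorphic_localGroup_liftedGroup hT hsmul hp u E (by rwa [hpu]) ?_ ?_
    · simpa only [hpu, smul_cosetGraph_base] using hE₁
    · simpa only [hpu, smul_cosetGraph_base] using hE₂
  · obtain ⟨E, hE, hE₁, hE₂⟩ := h₂.exists_label ht₂
    refine permIsomorphic_localGroup_liftedGroup hT hsmul hp v E (by rwa [hpv]) ?_ ?_
    · simpa only [hpv, smul_cosetGraph_base] using hE₁
    · simpa only [hpv, smul_cosetGraph_base] using hE₂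
  · have hfix : ∀ c : ↥(S true ⊓ S false), ∃ g : T ≃g T, g u = u ∧ ∀ y, p (g y) = (c : H) • p y :=
      fun c => hlift c u u (by rw [hpu, smul_cosetGraph_base.2 c.2.1])
    choose Φ hΦu hΦ using hfix
    have hΦv : ∀ c, Φ c v = v := fun c => by
      refine hp.eq_of_adj (x := u) ?_ huv ?_
      · have := (Φ c).map_adj_iff.2 huv
        rwa [hΦu] at this
      · rw [hΦ, hpv, smul_cosetGraph_base.2 c.2.2]
    refine ⟨Equiv.ofBijective (fun c => ⟨Φ c, ⟨mem_liftedGroup.2 ⟨c, hΦ c⟩, hΦu c⟩,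
      ⟨mem_liftedGroup.2 ⟨c, hΦ c⟩, hΦv c⟩⟩) ⟨?_, ?_⟩⟩
    · intro c c' hcc
      have hcc : Φ c = Φ c' := congrArg Subtype.val hcc
      refine Subtype.ext (inv_mul_eq_one.1 (hfaith ((c : H)⁻¹ * c') fun x => ?_))
      rw [mul_smul, inv_smul_eq_iff, ← hΦ, ← hΦ, hcc]
    · rintro ⟨g, ⟨hgG, hgu⟩, -, hgv⟩
      obtain ⟨h, hh⟩ := mem_liftedGroup.1 hgG
      have hu' := hh u
      have hv' := hh v
      rw [hgu, hpu, eq_comm, smul_cosetGraph_base] at hu'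
      rw [hgv, hpv, eq_comm, smul_cosetGraph_base] at hv'
      refine ⟨⟨h, hu', hv'⟩, Subtype.ext (RelIso.ext fun x => congrFun ?_ x)⟩
      refine hp.lift_unique hT.1 (fun a b hab => ?_) (fun a b hab => ?_) (fun y => ?_) u ?_
      · exact (Φ ⟨h, hu', hv'⟩).map_adj_iff.2 hab
      · exact g.map_adj_iff.2 hab
      · rw [hΦ, hh]
      · rw [hΦu, hgu]

end Realise

end SimpleGraph

open Equiv (Perm)

/-! ### Positions -/

/-- A set `I` of positions, coloured by `Δ` and with a base position of colour `d₀`, on which the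
permutations of `Δ` act through `X` and those of `Ψ` through `P`.  The action `X` fixes the base
position and is compatible with the colours away from it; the action `P` preserves the colours, and
the permutations fixing `δ₀` fix the base position.  The two actions commute only as far as stated,
and together they connect all positions. -/
structure Positions {Ψ Δ : Type*} (M : Subgroup (Perm Ψ)) (δ₀ : Ψ) (d₀ : Δ) (I : Type*) where
  base : I
  colour : I → Δ
  X : Perm Δ →* Perm I
  P : Perm Ψ →* Perm I
  colour_base : colour base = d₀
  X_base : ∀ l, X l base = base
  colour_X : ∀ l i, i ≠ base → colour (X l i) = l (colour i)
  colour_P : ∀ m i, colour (P m i) = colour i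
  commute_of_block : ∀ m l, l d₀ = d₀ → Commute (P m) (X l)
  commute_of_top : ∀ m l, m δ₀ = δ₀ → Commute (P m) (X l)
  P_base : ∀ m, m δ₀ = δ₀ → P m base = base
  connected : ∀ (Λ : Subgroup (Perm Δ)) (s : Set I), IsTransitivePerm Λ → base ∈ s →
    (∀ m ∈ M, ∀ i ∈ s, P m i ∈ s) → (∀ l ∈ Λ, ∀ i ∈ s, X l i ∈ s) → ∀ i, i ∈ s

/-- Every finite nonempty type `Q` carries, after adding a point, a permutation with a single
cycle. -/
theorem exists_perm_option_transitive (Q : Type*) [Finite Q] :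
    ∃ θ : Perm (Option Q), ∀ s : Set (Option Q), none ∈ s → (∀ x ∈ s, θ x ∈ s) → ∀ x, x ∈ s := by
  obtain ⟨n, ⟨e⟩⟩ := Finite.exists_equiv_fin Q
  let e' : Fin (n + 1) ≃ Option Q := (finSuccEquiv n).trans (Equiv.optionCongr e.symm)
  have he' : e' 0 = none := by simp [e']
  refine ⟨e'.permCongr (finRotate (n + 1)), fun s h0 hs x => ?_⟩
  have key : ∀ i : Fin (n + 1), e' i ∈ s := by
    intro i
    induction i using Fin.induction with
    | zero => rwa [he']
    | succ i ih =>
      have := hs _ ih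
      rw [Equiv.permCongr_apply, Equiv.symm_apply_apply, finRotate_apply] at this
      rwa [Fin.coeSucc_eq_succ] at this
  simpa using key (e'.symm x)

theorem Equiv.Perm.apply_inv_self {α : Type*} (f : Perm α) (x : α) : f (f⁻¹ x) = x :=
  f.apply_symm_apply x

theorem Equiv.Perm.inv_apply_self {α : Type*} (f : Perm α) (x : α) : f⁻¹ (f x) = x :=
  f.symm_apply_apply x

theorem Equiv.Perm.commute_viaEmbedding {α β : Type*} (θ : Perm α) (ι : α ↪ β) (g : Perm β)
    (hg : ∀ x, g (ι x) = ι x) : Commute g (θ.viaEmbedding ι) := by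
  ext y
  rw [Perm.mul_apply, Perm.mul_apply]
  by_cases hy : y ∈ Set.range ι
  · obtain ⟨x, rfl⟩ := hy
    rw [hg, Perm.viaEmbedding_apply, hg]
  · have hgy : g y ∉ Set.range ι := by
      rintro ⟨x, hx⟩
      exact hy ⟨x, g.injective (by rw [hg, hx])⟩
    rw [Perm.viaEmbedding_apply_of_notMem _ _ _ hy, Perm.viaEmbedding_apply_of_notMem _ _ _ hgy]

section Index

variable {Ψ Q Δ : Type*}

/-- The action of the permutations of `Δ` on positions. -/
def blockAct (Ψ Q Δ : Type*) : Perm Δ →* Perm (Option ((Ψ × Q) × Δ)) where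
  toFun l := Equiv.optionCongr (Equiv.prodCongr (Equiv.refl _) l)
  map_one' := by ext (_ | ⟨j, d⟩) <;> simp
  map_mul' a b := by ext (_ | ⟨j, d⟩) <;> simp

/-- The natural action of the permutations of `Ψ` on positions. -/
def topAct (Ψ Q Δ : Type*) : Perm Ψ →* Perm (Option ((Ψ × Q) × Δ)) where
  toFun m := Equiv.optionCongr (Equiv.prodCongr (Equiv.prodCongr m (Equiv.refl _)) (Equiv.refl _))
  map_one' := by ext (_ | ⟨⟨p, q⟩, d⟩) <;> simp
  map_mul' a b := by ext (_ | ⟨⟨p, q⟩, d⟩) <;> simp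

@[simp] theorem blockAct_some (l : Perm Δ) (j : Ψ × Q) (d : Δ) :
    blockAct Ψ Q Δ l (some (j, d)) = some (j, l d) := rfl

@[simp] theorem topAct_some (m : Perm Ψ) (p : Ψ) (q : Q) (d : Δ) :
    topAct Ψ Q Δ m (some ((p, q), d)) = some ((m p, q), d) := rfl

/-- The positions which are permuted cyclically: the base position and those lying over `δ₀` and
`d₀`. -/
def spine (Q : Type*) (δ₀ : Ψ) (d₀ : Δ) : Option Q ↪ Option ((Ψ × Q) × Δ) where
  toFun := Option.map fun q => ((δ₀, q), d₀)
  inj' := Option.map_injective fun q q' h => by simpa using h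

theorem spine_none (δ₀ : Ψ) (d₀ : Δ) : spine Q δ₀ d₀ none = none := rfl

theorem spine_some (δ₀ : Ψ) (d₀ : Δ) (q : Q) : spine Q δ₀ d₀ (some q) = some ((δ₀, q), d₀) := rfl

theorem notMem_range_spine_of_block {δ₀ : Ψ} {d₀ d : Δ} (h : d ≠ d₀) (j : Ψ × Q) :
    some (j, d) ∉ Set.range (spine Q δ₀ d₀) := by
  rintro ⟨_ | q, hq⟩
  · rw [spine_none] at hq; cases hq
  · rw [spine_some] at hq; cases hq; exact h rfl

theorem notMem_range_spine_of_top {δ₀ p : Ψ} {d₀ d : Δ} (h : p ≠ δ₀) (q : Q) :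
    some ((p, q), d) ∉ Set.range (spine Q δ₀ d₀) := by
  rintro ⟨_ | q, hq⟩
  · rw [spine_none] at hq; cases hq
  · rw [spine_some] at hq; cases hq; exact h rfl

/-- Twisting the natural action of `Perm Ψ` by a cycle on the spine makes it move the base
position.  The untwisted action is still visible on the positions of colour other than `d₀`, and
the two together connect all positions. -/
theorem exists_positions [Finite Q] {M : Subgroup (Perm Ψ)} (hM : IsTransitivePerm M) (δ₀ : Ψ)
    (d₀ d₁ : Δ) (hd : d₁ ≠ d₀) (m₁ : Perm Ψ) (hm₁ : m₁ ∈ M) (hm₁' : m₁ δ₀ ≠ δ₀) :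
    ∃ D : Positions M δ₀ d₀ (Option ((Ψ × Q) × Δ)),
      ∀ j : Ψ × Q, D.colour (some (j, d₀)) = d₀ := by
  classical
  obtain ⟨θ, hθ⟩ := exists_perm_option_transitive Q
  set ι := spine Q δ₀ d₀ with hι
  set t := θ.viaEmbedding ι with ht
  set X := blockAct Ψ Q Δ
  set Y := topAct Ψ Q Δ
  let P : Perm Ψ →* Perm (Option ((Ψ × Q) × Δ)) := (MulAut.conj t⁻¹).toMonoidHom.comp Y
  have hP : ∀ m i, P m i = t⁻¹ (Y m (t i)) := fun m i => by simp [P]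
  let col : Option ((Ψ × Q) × Δ) → Δ := fun i => i.elim d₀ Prod.snd
  have hcolι : ∀ x, col (ι x) = d₀ := by rintro (_ | q) <;> rfl
  have hcolt : ∀ i, col (t i) = col i := by
    intro i
    by_cases hi : i ∈ Set.range ι
    · obtain ⟨x, rfl⟩ := hi
      rw [ht, Perm.viaEmbedding_apply, hcolι, hcolι]
    · rw [ht, Perm.viaEmbedding_apply_of_notMem _ _ _ hi]
  have hcolY : ∀ m i, col (Y m i) = col i := by
    rintro m (_ | ⟨⟨p, q⟩, d⟩) <;> rfl
  have hXι : ∀ l : Perm Δ, l d₀ = d₀ → ∀ x, X l (ι x) = ι x := by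
    rintro l hl (_ | q)
    · rfl
    · simp [hι, spine_some, X, hl]
  have hYι : ∀ m : Perm Ψ, m δ₀ = δ₀ → ∀ x, Y m (ι x) = ι x := by
    rintro m hm (_ | q)
    · rfl
    · simp [hι, spine_some, Y, hm]
  have hYX : ∀ m l, Commute (Y m) (X l) := by
    intro m l
    ext (_ | ⟨⟨p, q⟩, d⟩) <;> rfl
  have hPY : ∀ m, m δ₀ = δ₀ → P m = Y m := by
    intro m hm
    have := Perm.commute_viaEmbedding θ ι _ (hYι m hm)
    ext1 i
    rw [hP, Perm.inv_eq_iff_eq]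
    exact Perm.ext_iff.1 this.eq i
  refine ⟨{
    base := none
    colour := col
    X := X
    P := P
    colour_base := rfl
    X_base := fun l => rfl
    colour_X := ?_
    colour_P := ?_
    commute_of_block := ?_
    commute_of_top := ?_
    P_base := ?_
    connected := ?_ }, fun j => rfl⟩
  · rintro l (_ | ⟨j, d⟩) hi
    · exact (hi rfl).elim
    · rfl
  · intro m i
    rw [hP, ← hcolt, Perm.apply_inv_self, hcolY, hcolt]
  · intro m l hl
    have h1 : Commute t (X l) := (Perm.commute_viaEmbedding θ ι _ (hXι l hl)).symm
    have h2 : P m = t⁻¹ * Y m * t := by ext1 i; rw [hP]; rfl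
    rw [h2]
    exact (h1.inv_left.mul_left (hYX m l)).mul_left h1
  · intro m l hm
    rw [hPY m hm]
    exact hYX m l
  · intro m hm
    rw [hPY m hm]
    rfl
  · intro Λ s hΛ h0 hsP hsX
    -- away from the colour `d₀` the twist is trivial, so that `s` is closed under the untwisted
    -- action too
    have hsY : ∀ m ∈ M, ∀ i ∈ s, Y m i ∈ s := by
      rintro m hm (_ | ⟨⟨p, q⟩, d⟩) hi
      · exact hi
      · obtain ⟨⟨l, hl⟩, hld⟩ := hΛ.exists_smul_eq d d₁
        have hld : l d = d₁ := hld
        have h1 : some ((p, q), d₁) ∈ s := by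
          have := hsX l hl _ hi
          rwa [blockAct_some, hld] at this
        have h2 : some ((m p, q), d₁) ∈ s := by
          have := hsP m hm _ h1
          rw [hP, ht, Perm.viaEmbedding_apply_of_notMem _ _ _ (notMem_range_spine_of_block hd _),
            topAct_some] at this
          convert this using 1
          rw [Perm.eq_inv_iff_eq,
            Perm.viaEmbedding_apply_of_notMem _ _ _ (notMem_range_spine_of_block hd _)]
        have h3 := hsX l⁻¹ (inv_mem hl) _ h2
        rwa [blockAct_some, ← hld, Perm.inv_apply_self] at h3
    have hspine : ∀ x, ι x ∈ s := by
      refine hθ {x | ι x ∈ s} h0 fun x hx => ?_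
      rcases hx' : θ x with _ | q
      · exact h0
      · have h1 : some ((m₁ δ₀, q), d₀) ∈ s := by
          have := hsP m₁ hm₁ _ hx
          rw [hP, ht, Perm.viaEmbedding_apply, hx', hι, spine_some, topAct_some] at this
          convert this using 1
          rw [Perm.eq_inv_iff_eq,
            Perm.viaEmbedding_apply_of_notMem _ _ _ (notMem_range_spine_of_top hm₁' _)]
        have h2 := hsY m₁⁻¹ (inv_mem hm₁) _ h1
        rwa [topAct_some, Perm.inv_apply_self] at h2
    rintro (_ | ⟨⟨p, q⟩, d⟩)
    · exact h0
    · obtain ⟨⟨l, hl⟩, hld⟩ := hΛ.exists_smul_eq d₀ d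
      obtain ⟨⟨m, hm⟩, hmp⟩ := hM.exists_smul_eq δ₀ p
      have hld : l d₀ = d := hld
      have hmp : m δ₀ = p := hmp
      have := hsX l hl _ (hsY m hm _ (hspine (some q)))
      rwa [hι, spine_some, topAct_some, blockAct_some, hld, hmp] at this

end Index

/-! ### The amalgam -/

/-- The ambient group of the amalgam, with elements consisting of a permutation of `Δ`, a
permutation of `Ψ`, and an element of the wreath product of `Perm Ω` by `Perm I`.  The latter acts
on `I × Ω` by `(i, x) ↦ (perm i, coeff i x)`. -/
@[ext]
structure Dressing (Δ Ψ I Ω : Type*) where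
  block : Perm Δ
  top : Perm Ψ
  perm : Perm I
  coeff : I → Perm Ω

namespace Dressing

variable {Δ Ψ I Ω : Type*}

instance : Mul (Dressing Δ Ψ I Ω) :=
  ⟨fun a b => ⟨a.block * b.block, a.top * b.top, a.perm * b.perm,
    fun i => a.coeff (b.perm i) * b.coeff i⟩⟩

instance : One (Dressing Δ Ψ I Ω) := ⟨⟨1, 1, 1, 1⟩⟩

instance : Inv (Dressing Δ Ψ I Ω) :=
  ⟨fun a => ⟨a.block⁻¹, a.top⁻¹, a.perm⁻¹, fun i => (a.coeff (a.perm⁻¹ i))⁻¹⟩⟩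

@[simp] theorem mul_block (a b : Dressing Δ Ψ I Ω) : (a * b).block = a.block * b.block := rfl
@[simp] theorem mul_top (a b : Dressing Δ Ψ I Ω) : (a * b).top = a.top * b.top := rfl
@[simp] theorem mul_perm (a b : Dressing Δ Ψ I Ω) : (a * b).perm = a.perm * b.perm := rfl
@[simp] theorem mul_coeff (a b : Dressing Δ Ψ I Ω) (i : I) :
    (a * b).coeff i = a.coeff (b.perm i) * b.coeff i := rfl
@[simp] theorem one_block : (1 : Dressing Δ Ψ I Ω).block = 1 := rfl
@[simp] theorem one_top : (1 : Dressing Δ Ψ I Ω).top = 1 := rfl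
@[simp] theorem one_perm : (1 : Dressing Δ Ψ I Ω).perm = 1 := rfl
@[simp] theorem one_coeff (i : I) : (1 : Dressing Δ Ψ I Ω).coeff i = 1 := rfl
@[simp] theorem inv_block (a : Dressing Δ Ψ I Ω) : a⁻¹.block = a.block⁻¹ := rfl
@[simp] theorem inv_top (a : Dressing Δ Ψ I Ω) : a⁻¹.top = a.top⁻¹ := rfl
@[simp] theorem inv_perm (a : Dressing Δ Ψ I Ω) : a⁻¹.perm = a.perm⁻¹ := rfl
@[simp] theorem inv_coeff (a : Dressing Δ Ψ I Ω) (i : I) :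
    a⁻¹.coeff i = (a.coeff (a.perm⁻¹ i))⁻¹ := rfl

instance : Group (Dressing Δ Ψ I Ω) :=
  Group.ofLeftAxioms
    (fun a b c => by ext1 <;> simp [mul_assoc, funext_iff])
    (fun a => by ext1 <;> simp [funext_iff])
    (fun a => by ext1 <;> simp [funext_iff])

instance [Finite Δ] [Finite Ψ] [Finite I] [Finite Ω] : Finite (Dressing Δ Ψ I Ω) :=
  Finite.of_injective
    (fun a : Dressing Δ Ψ I Ω => (a.block, a.top, a.perm, a.coeff)) (by
      intro a b h
      simp only [Prod.mk.injEq] at h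
      exact Dressing.ext h.1 h.2.1 h.2.2.1 h.2.2.2)

end Dressing

section Amalgam

variable {Δ Ψ I Ω : Type*} {L : Subgroup (Perm Ω)} {M : Subgroup (Perm Ψ)} {δ₀ : Ψ} {d₀ : Δ}
  {π : Ω → Δ} {o : Δ → Ω}

/-- The conditions common to both groups of the amalgam: all coefficients lie in `L` and induce the
same permutation of `Δ`, and the action on positions is the prescribed one. -/
structure Positions.Admissible (D : Positions M δ₀ d₀ I) (L : Subgroup (Perm Ω)) (π : Ω → Δ)
    (a : Dressing Δ Ψ I Ω) : Prop where
  top_mem : a.top ∈ M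
  coeff_mem : ∀ i, a.coeff i ∈ L
  proj_coeff : ∀ i x, π (a.coeff i x) = a.block (π x)
  perm_eq : a.perm = D.P a.top * D.X a.block

namespace Positions

variable (D : Positions M δ₀ d₀ I)

variable {D} in
theorem Admissible.one : D.Admissible L π 1 :=
  ⟨one_mem _, fun _ => one_mem _, fun _ _ => rfl, by simp⟩

variable {D} in
theorem Admissible.mul {a b : Dressing Δ Ψ I Ω} (ha : D.Admissible L π a)
    (hb : D.Admissible L π b) (hc : Commute (D.P b.top) (D.X a.block)) :
    D.Admissible L π (a * b) where
  top_mem := mul_mem ha.top_mem hb.top_mem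
  coeff_mem _ := mul_mem (ha.coeff_mem _) (hb.coeff_mem _)
  proj_coeff i x := by simp [ha.proj_coeff, hb.proj_coeff]
  perm_eq := by
    rw [Dressing.mul_perm, ha.perm_eq, hb.perm_eq, Dressing.mul_top, Dressing.mul_block,
      map_mul, map_mul, mul_assoc, mul_assoc, ← mul_assoc (D.X _), ← hc.eq, mul_assoc]

variable {D} in
theorem Admissible.inv {a : Dressing Δ Ψ I Ω} (ha : D.Admissible L π a)
    (hc : Commute (D.P a.top) (D.X a.block)) : D.Admissible L π a⁻¹ where
  top_mem := inv_mem ha.top_mem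
  coeff_mem _ := inv_mem (ha.coeff_mem _)
  proj_coeff i x := by
    rw [Dressing.inv_block, Perm.eq_inv_iff_eq, ← ha.proj_coeff (a.perm⁻¹ i), Dressing.inv_coeff,
      Perm.apply_inv_self]
  perm_eq := by
    rw [Dressing.inv_perm, ha.perm_eq, Dressing.inv_top, Dressing.inv_block, map_inv, map_inv,
      hc.eq, mul_inv_rev]

variable {D} in
theorem Admissible.colour_perm {a : Dressing Δ Ψ I Ω} (ha : D.Admissible L π a) {i : I}
    (hi : i ≠ D.base ∨ a.block d₀ = d₀) : D.colour (a.perm i) = a.block (D.colour i) := by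
  rw [ha.perm_eq, Perm.mul_apply, D.colour_P]
  by_cases h : i = D.base
  · rw [h, D.X_base, D.colour_base, hi.resolve_left (fun h' => h' h)]
  · exact D.colour_X _ _ h

variable {D} in
theorem Admissible.perm_base {a : Dressing Δ Ψ I Ω} (ha : D.Admissible L π a)
    (hm : a.top δ₀ = δ₀) : a.perm D.base = D.base := by
  rw [ha.perm_eq, Perm.mul_apply, D.X_base, D.P_base _ hm]

/-- The group inducing `L`: the permutation of `Ψ` fixes `δ₀`, and away from the base position
the coefficients permute the chosen representatives `o d`; at the base position the coefficient is
free. -/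
def leftGroup (L : Subgroup (Perm Ω)) (π : Ω → Δ) (o : Δ → Ω) :
    Subgroup (Dressing Δ Ψ I Ω) where
  carrier := {a | D.Admissible L π a ∧ a.top δ₀ = δ₀ ∧
    ∀ i, i ≠ D.base → a.coeff i (o (D.colour i)) = o (a.block (D.colour i))}
  one_mem' := ⟨.one, rfl, fun _ _ => rfl⟩
  mul_mem' := by
    rintro a b ⟨ha, hat, hao⟩ ⟨hb, hbt, hbo⟩
    refine ⟨ha.mul hb (D.commute_of_top _ _ hbt), by simp [hat, hbt], fun i hi => ?_⟩
    have hbi : b.perm i ≠ D.base := by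
      rw [← hb.perm_base hbt]
      exact b.perm.injective.ne hi
    rw [Dressing.mul_coeff, Perm.mul_apply, hbo i hi, ← hb.colour_perm (Or.inl hi), hao _ hbi,
      hb.colour_perm (Or.inl hi)]
    rfl
  inv_mem' := by
    rintro a ⟨ha, hat, hao⟩
    refine ⟨ha.inv (D.commute_of_top _ _ hat), by rw [Dressing.inv_top, Perm.inv_eq_iff_eq, hat],
      fun i hi => ?_⟩
    have hai : a.perm⁻¹ i ≠ D.base := by
      rw [Ne, Perm.inv_eq_iff_eq, ha.perm_base hat]
      exact hi
    have h := ha.colour_perm (Or.inl hai)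
    rw [Perm.apply_inv_self] at h
    rw [Dressing.inv_coeff, Perm.inv_eq_iff_eq, Dressing.inv_block, h, Perm.inv_apply_self,
      hao _ hai]

/-- The group inducing `M`: the permutation of `Δ` fixes `d₀`, and at all positions the
coefficients permute the chosen representatives `o d`. -/
def rightGroup (L : Subgroup (Perm Ω)) (π : Ω → Δ) (o : Δ → Ω) :
    Subgroup (Dressing Δ Ψ I Ω) where
  carrier := {a | D.Admissible L π a ∧ a.block d₀ = d₀ ∧
    ∀ i, a.coeff i (o (D.colour i)) = o (a.block (D.colour i))}
  one_mem' := ⟨.one, rfl, fun _ => rfl⟩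
  mul_mem' := by
    rintro a b ⟨ha, hat, hao⟩ ⟨hb, hbt, hbo⟩
    refine ⟨ha.mul hb (D.commute_of_block _ _ hat), by simp [hat, hbt], fun i => ?_⟩
    rw [Dressing.mul_coeff, Perm.mul_apply, hbo i, ← hb.colour_perm (Or.inr hbt), hao _,
      hb.colour_perm (Or.inr hbt)]
    rfl
  inv_mem' := by
    rintro a ⟨ha, hat, hao⟩
    refine ⟨ha.inv (D.commute_of_block _ _ hat),
      by rw [Dressing.inv_block, Perm.inv_eq_iff_eq, hat], fun i => ?_⟩
    have h := ha.colour_perm (i := a.perm⁻¹ i) (Or.inr hat)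
    rw [Perm.apply_inv_self] at h
    rw [Dressing.inv_coeff, Perm.inv_eq_iff_eq, Dressing.inv_block, h, Perm.inv_apply_self,
      hao _]

variable {D}

/-- Every element of `L` is the coefficient at the base position of some element of the left group:
as the fibres of `π` are orbits of a subgroup of `L`, the other coefficients can be corrected to
preserve the representatives. -/
theorem exists_mem_leftGroup (ho : ∀ d, π (o d) = d)
    (hK : ∀ x y, π x = π y → ∃ k ∈ L, k x = y ∧ ∀ z, π (k z) = π z) {l : Perm Ω} (hl : l ∈ L)
    {b : Perm Δ} (hb : ∀ x, π (l x) = b (π x)) :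
    ∃ a ∈ D.leftGroup L π o, a.coeff D.base = l ∧ a.block = b ∧ a.top = 1 := by
  classical
  have hk : ∀ d, ∃ k ∈ L, k (l (o d)) = o (b d) ∧ ∀ z, π (k z) = π z :=
    fun d => hK _ _ (by rw [hb, ho, ho])
  choose k hkL hko hkπ using hk
  refine ⟨⟨b, 1, D.X b, fun i => if i = D.base then l else k (D.colour i) * l⟩,
    ⟨⟨one_mem _, fun i => ?_, fun i x => ?_, by simp⟩, rfl, fun i hi => ?_⟩, by simp, rfl, rfl⟩
  · dsimp only
    split_ifs
    exacts [hl, mul_mem (hkL _) hl]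
  · dsimp only
    split_ifs
    · exact hb x
    · rw [Perm.mul_apply, hkπ, hb]
  · simp only [if_neg hi, Perm.mul_apply, hko]

theorem mem_rightGroup_of_top {m : Perm Ψ} (hm : m ∈ M) :
    (⟨1, m, D.P m, 1⟩ : Dressing Δ Ψ I Ω) ∈ D.rightGroup L π o :=
  ⟨⟨hm, fun _ => one_mem _, fun _ _ => rfl, by simp⟩, rfl, fun _ => rfl⟩

/-- The stabiliser in the left group of the point `o d₀` is the intersection of the two groups. -/
theorem mem_rightGroup_iff_of_mem_leftGroup (ho : ∀ d, π (o d) = d) {a : Dressing Δ Ψ I Ω}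
    (ha : a ∈ D.leftGroup L π o) :
    a.coeff D.base (o d₀) = o d₀ ↔ a ∈ D.rightGroup L π o := by
  obtain ⟨h1, h2, h3⟩ := ha
  constructor
  · intro h
    have hd : a.block d₀ = d₀ := by
      have := h1.proj_coeff D.base (o d₀)
      rw [h, ho] at this
      exact this.symm
    refine ⟨h1, hd, fun i => ?_⟩
    by_cases hi : i = D.base
    · rw [hi, D.colour_base, hd, h]
    · exact h3 i hi
  · rintro ⟨-, hd, h⟩
    have := h D.base
    rwa [D.colour_base, hd] at this

/-- The stabiliser in the right group of the point `δ₀` is the intersection of the two groups. -/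
theorem mem_leftGroup_iff_of_mem_rightGroup {a : Dressing Δ Ψ I Ω}
    (ha : a ∈ D.rightGroup L π o) : a.top δ₀ = δ₀ ↔ a ∈ D.leftGroup L π o :=
  ⟨fun h => ⟨ha.1, h, fun i _ => ha.2.2 i⟩, fun h => h.2.1⟩

variable (D) in
/-- The amalgam as a pair of subgroups. -/
def amalgam (L : Subgroup (Perm Ω)) (π : Ω → Δ) (o : Δ → Ω) (i : Bool) :
    Subgroup (Dressing Δ Ψ I Ω) :=
  bif i then D.leftGroup L π o else D.rightGroup L π o

open SimpleGraph

theorem inducesOnCosets_left (ho : ∀ d, π (o d) = d)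
    (hK : ∀ x y, π x = π y → ∃ k ∈ L, k x = y ∧ ∀ z, π (k z) = π z)
    (hL : ∀ l ∈ L, ∃ b : Perm Δ, ∀ x, π (l x) = b (π x)) :
    InducesOnCosets (D.amalgam L π o) true L := by
  refine ⟨MonoidHom.mk' (fun a : D.leftGroup L π o => a.1.coeff D.base) fun a b => ?_, o d₀,
    ?_, fun a => mem_rightGroup_iff_of_mem_leftGroup ho a.2⟩
  · rw [Subgroup.coe_mul, Dressing.mul_coeff, b.2.1.perm_base b.2.2.1]
  · ext l
    constructor
    · rintro ⟨a, rfl⟩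
      exact a.2.1.coeff_mem _
    · intro hl
      obtain ⟨b, hb⟩ := hL l hl
      obtain ⟨a, ha, rfl, -⟩ := exists_mem_leftGroup (D := D) ho hK hl hb
      exact ⟨⟨a, ha⟩, rfl⟩

theorem inducesOnCosets_right : InducesOnCosets (D.amalgam L π o) false M := by
  refine ⟨MonoidHom.mk' (fun a : D.rightGroup L π o => a.1.top) fun a b => rfl, δ₀,
    ?_, fun a => mem_leftGroup_iff_of_mem_rightGroup a.2⟩
  ext m
  constructor
  · rintro ⟨a, rfl⟩
    exact a.2.1.top_mem
  · intro hm
    exact ⟨⟨_, mem_rightGroup_of_top hm⟩, rfl⟩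

/-- The amalgam is faithful.  An element of a subgroup of the intersection normalised by both
groups has trivial components in `Perm Δ` and `Perm Ψ` and trivial coefficient at the base
position, because `L` and `M` act faithfully; the set of positions where all coefficients are
trivial is then invariant under both groups. -/
theorem eq_bot_of_normalized (ho : ∀ d, π (o d) = d)
    (hK : ∀ x y, π x = π y → ∃ k ∈ L, k x = y ∧ ∀ z, π (k z) = π z)
    (hL : ∀ l ∈ L, ∃ b : Perm Δ, ∀ x, π (l x) = b (π x))
    (hLt : IsTransitivePerm L) (hMt : IsTransitivePerm M)
    (N : Subgroup (Dressing Δ Ψ I Ω)) (hN : ∀ i, N ≤ D.amalgam L π o i)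
    (hnorm : ∀ i, ∀ a ∈ D.amalgam L π o i, ∀ n ∈ N, a * n * a⁻¹ ∈ N) : N = ⊥ := by
  have hNl : N ≤ D.leftGroup L π o := hN true
  have hNr : N ≤ D.rightGroup L π o := hN false
  have hnl : ∀ a ∈ D.leftGroup L π o, ∀ n ∈ N, a * n * a⁻¹ ∈ N := hnorm true
  have hnr : ∀ a ∈ D.rightGroup L π o, ∀ n ∈ N, a * n * a⁻¹ ∈ N := hnorm false
  have htop : ∀ n ∈ N, n.top = 1 := by
    intro n hn
    ext1 δ
    obtain ⟨⟨m, hm⟩, hmδ⟩ := hMt.exists_smul_eq δ δ₀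
    have hmδ : m δ = δ₀ := hmδ
    have h1 := (hNl (hnr _ (mem_rightGroup_of_top hm) n hn)).2.1
    simp only [Dressing.mul_top, Dressing.inv_top, Perm.mul_apply] at h1
    rw [← Perm.eq_inv_iff_eq, Perm.inv_eq_iff_eq.2 hmδ.symm] at h1
    exact h1
  have hperm_base : ∀ a ∈ D.leftGroup L π o, a.perm D.base = D.base :=
    fun a ha => ha.1.perm_base ha.2.1
  have hbase : ∀ n ∈ N, n.coeff D.base = 1 := by
    intro n hn
    ext1 x
    obtain ⟨⟨l, hl⟩, hlx⟩ := hLt.exists_smul_eq x (o d₀)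
    have hlx : l x = o d₀ := hlx
    obtain ⟨b, hb⟩ := hL l hl
    obtain ⟨a, ha, hal, -⟩ := exists_mem_leftGroup (D := D) ho hK hl hb
    have hc := hnl a ha n hn
    have h1 := (mem_rightGroup_iff_of_mem_leftGroup ho (hNl hc)).2 (hNr hc)
    have hab : a.perm⁻¹ D.base = D.base := Perm.inv_eq_iff_eq.2 (hperm_base a ha).symm
    simp only [Dressing.mul_coeff, Dressing.inv_coeff, Dressing.inv_perm, hab,
      hperm_base n (hNl hn), hal, Perm.mul_apply] at h1
    rw [← Perm.eq_inv_iff_eq, Perm.inv_eq_iff_eq.2 hlx.symm] at h1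
    exact h1
  have hblock : ∀ n ∈ N, n.block = 1 := by
    intro n hn
    ext1 d
    have := (hNl hn).1.proj_coeff D.base (o d)
    rw [hbase n hn, Perm.one_apply, ho] at this
    exact this.symm
  have hperm : ∀ n ∈ N, n.perm = 1 := by
    intro n hn
    rw [(hNl hn).1.perm_eq, htop n hn, hblock n hn, map_one, map_one, one_mul]
  -- the set of positions with trivial coefficients is invariant under conjugation
  have hconj : ∀ a : Dressing Δ Ψ I Ω, (∀ n ∈ N, a⁻¹ * n * a ∈ N) → ∀ i,
      (∀ n ∈ N, n.coeff i = 1) → ∀ n ∈ N, n.coeff (a.perm i) = 1 := by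
    intro a ha i hi n hn
    have := hi _ (ha n hn)
    simp only [Dressing.mul_coeff, Dressing.inv_coeff, hperm n hn, Perm.one_apply,
      Perm.inv_apply_self] at this
    rw [mul_assoc, inv_mul_eq_one] at this
    exact right_eq_mul.1 this
  let Λ : Subgroup (Perm Δ) :=
    { carrier := {b | ∃ l ∈ L, ∀ x, π (l x) = b (π x)}
      one_mem' := ⟨1, one_mem _, fun _ => rfl⟩
      mul_mem' := by
        rintro b c ⟨l, hl, hlb⟩ ⟨k, hk, hkc⟩
        exact ⟨l * k, mul_mem hl hk, fun x => by simp [hlb, hkc]⟩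
      inv_mem' := by
        rintro b ⟨l, hl, hlb⟩
        exact ⟨l⁻¹, inv_mem hl, fun x => by rw [Perm.eq_inv_iff_eq, ← hlb, Perm.apply_inv_self]⟩ }
  have hΛ : IsTransitivePerm Λ := by
    refine ⟨fun d d' => ?_⟩
    obtain ⟨⟨l, hl⟩, hld⟩ := hLt.exists_smul_eq (o d) (o d')
    have hld : l (o d) = o d' := hld
    obtain ⟨b, hb⟩ := hL l hl
    refine ⟨⟨b, l, hl, hb⟩, ?_⟩
    change b d = d'
    rw [← ho d, ← hb, hld, ho]
  have hall := D.connected Λ {i | ∀ n ∈ N, n.coeff i = 1} hΛ hbase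
    (by
      intro m hm i hi
      refine hconj ⟨1, m, D.P m, 1⟩ (fun n hn => ?_) i hi
      have := hnr _ (inv_mem (mem_rightGroup_of_top hm)) n hn
      rwa [inv_inv] at this)
    (by
      rintro b ⟨l, hl, hb⟩ i hi
      obtain ⟨a, ha, -, hab, hat⟩ := exists_mem_leftGroup (D := D) ho hK hl hb
      have := hconj a (fun n hn => by
        have := hnl _ (inv_mem ha) n hn
        rwa [inv_inv] at this) i hi
      rwa [ha.1.perm_eq, hat, map_one, one_mul, hab] at this)
  rw [Subgroup.eq_bot_iff_forall]
  intro n hn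
  exact Dressing.ext (hblock n hn) (htop n hn) (hperm n hn) (funext fun i => hall i n hn)

/-- A nontrivial element of `L` fixing `o d₀` and all fibres of `π` can be used as a coefficient at
each position of colour `d₀`, which makes the intersection of the two groups large. -/
theorem card_le_card_amalgam [Finite Δ] [Finite Ψ] [Finite I] [Finite Ω] {k : Perm Ω} (hk : k ∈ L)
    (hk1 : k ≠ 1) (hko : k (o d₀) = o d₀) (hkπ : ∀ x, π (k x) = π x) :
    Nat.card {i // D.colour i = d₀} ≤
      Nat.card ↥(D.amalgam L π o true ⊓ D.amalgam L π o false) := by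
  classical
  have hr : ∀ i, D.colour i = d₀ →
      (⟨1, 1, 1, Pi.mulSingle i k⟩ : Dressing Δ Ψ I Ω) ∈ D.rightGroup L π o := by
    intro i hi
    refine ⟨⟨one_mem _, fun j => ?_, fun j x => ?_, by simp⟩, rfl, fun j => ?_⟩ <;>
      by_cases hj : j = i
    · subst hj; simpa using hk
    · simp [Pi.mulSingle_eq_of_ne hj, one_mem]
    · subst hj; simpa using hkπ x
    · simp [Pi.mulSingle_eq_of_ne hj]
    · subst hj; simpa [hi] using hko
    · simp [Pi.mulSingle_eq_of_ne hj]
  refine Nat.card_le_card_of_injective (fun i => ⟨⟨1, 1, 1, Pi.mulSingle i.1 k⟩,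
    (mem_leftGroup_iff_of_mem_rightGroup (hr i.1 i.2)).1 rfl, hr i.1 i.2⟩) ?_
  intro i j hij
  have h : Pi.mulSingle i.1 k = (Pi.mulSingle j.1 k : I → Perm Ω) :=
    congrArg Dressing.coeff (congrArg Subtype.val hij)
  by_contra hne
  have := congrFun h i.1
  rw [Pi.mulSingle_eq_same, Pi.mulSingle_eq_of_ne (fun e => hne (Subtype.ext e))] at this
  exact hk1 this

end Positions

end Amalgam

/-! ### Block systems from groups that are not semiprimitive -/

universe u v

/-- For a normal subgroup which is neither transitive nor semiregular, `π` is the projection to its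
orbits and `o` a choice of representatives, such that some `k ≠ 1` in the subgroup fixes `o d₀`. -/
theorem exists_blocks_of_not_isSemiprimitivePerm {Ω : Type u} {L : Subgroup (Perm Ω)}
    (hL : ¬ IsSemiprimitivePerm L) :
    ∃ (Δ : Type u) (π : Ω → Δ) (o : Δ → Ω) (d₀ d₁ : Δ) (k : Perm Ω),
      (∀ d, π (o d) = d) ∧ (∀ x y, π x = π y → ∃ k ∈ L, k x = y ∧ ∀ z, π (k z) = π z) ∧
      (∀ l ∈ L, ∃ b : Perm Δ, ∀ x, π (l x) = b (π x)) ∧ d₁ ≠ d₀ ∧ k ∈ L ∧ k ≠ 1 ∧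
      k (o d₀) = o d₀ ∧ ∀ x, π (k x) = π x := by
  classical
  unfold IsSemiprimitivePerm at hL
  push Not at hL
  obtain ⟨K, hKn, hKt, hKs⟩ := hL
  set K' := K.map L.subtype with hK'
  have hKL : ∀ k ∈ K', k ∈ L := by
    rintro _ ⟨k, -, rfl⟩
    exact k.2
  have hconj : ∀ l ∈ L, ∀ k ∈ K', l * k * l⁻¹ ∈ K' := by
    rintro l hl _ ⟨k, hk, rfl⟩
    exact ⟨⟨l, hl⟩ * k * ⟨l, hl⟩⁻¹, hKn.conj_mem k hk _, rfl⟩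
  unfold IsSemiregularPerm at hKs
  push Not at hKs
  obtain ⟨k, hk, ω, hkω, hk1⟩ := hKs
  let R : Setoid Ω :=
    { r := fun x y => ∃ k ∈ K', k x = y
      iseqv :=
        { refl := fun x => ⟨1, one_mem _, rfl⟩
          symm := by
            rintro x y ⟨k, hk, rfl⟩
            exact ⟨k⁻¹, inv_mem hk, Perm.inv_apply_self _ _⟩
          trans := by
            rintro x y z ⟨k, hk, rfl⟩ ⟨k', hk', rfl⟩
            exact ⟨k' * k, mul_mem hk' hk, rfl⟩ } }
  let π : Ω → Quotient R := Quotient.mk R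
  have hπ : ∀ x y, π x = π y ↔ ∃ k ∈ K', k x = y := fun x y => Quotient.eq
  have hkπ : ∀ k ∈ K', ∀ x, π (k x) = π x := fun k hk x => ((hπ _ _).2 ⟨k, hk, rfl⟩).symm
  have hmap : ∀ l ∈ L, ∀ x y, π x = π y → π (l x) = π (l y) := by
    intro l hl x y hxy
    obtain ⟨k, hk, rfl⟩ := (hπ _ _).1 hxy
    exact (hπ _ _).2 ⟨_, hconj l hl k hk, by simp⟩
  obtain ⟨d₁, hd₁⟩ : ∃ d₁, d₁ ≠ π ω := by
    by_contra! h
    refine hKt ⟨fun x y => ?_⟩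
    obtain ⟨k, hk, hkxy⟩ := (hπ x y).1 ((h _).trans (h _).symm)
    exact ⟨⟨k, hk⟩, hkxy⟩
  let o : Quotient R → Ω := fun d => if d = π ω then ω else d.out
  have hoω : o (π ω) = ω := if_pos rfl
  refine ⟨Quotient R, π, o, π ω, d₁, k, fun d => ?_, fun x y hxy => ?_, fun l hl => ?_, hd₁,
    hKL k hk, hk1, by rw [hoω, hkω], hkπ k hk⟩
  · by_cases hd : d = π ω
    · rw [hd, hoω]
    · simp only [o, if_neg hd]
      exact d.out_eq
  · obtain ⟨k, hk, hkxy⟩ := (hπ x y).1 hxy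
    exact ⟨k, hKL k hk, hkxy, hkπ k hk⟩
  · refine ⟨Quotient.congr l fun x y => ?_, fun x => rfl⟩
    change R.r x y ↔ R.r (l x) (l y)
    refine (hπ x y).symm.trans (Iff.trans ⟨hmap l hl x y, fun h => ?_⟩ (hπ (l x) (l y)))
    simpa [Perm.inv_apply_self] using hmap l⁻¹ (inv_mem hl) _ _ h

/-- A transitive group which is not semiprimitive and a nontrivial transitive group are induced by
the two groups of a faithful finite amalgam with arbitrarily large intersection. -/
theorem exists_amalgam_of_not_isSemiprimitivePerm {Ω : Type u} {Ψ : Type v} [Finite Ω] [Finite Ψ]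
    {L : Subgroup (Perm Ω)} {M : Subgroup (Perm Ψ)} (hL : ¬ IsSemiprimitivePerm L)
    (hLt : IsTransitivePerm L) (hMt : IsTransitivePerm M) (hM : M ≠ ⊥) (n : ℕ) :
    ∃ (H : Type (max u v)) (_ : Group H) (S : Bool → Subgroup H),
      SimpleGraph.InducesOnCosets S true L ∧ SimpleGraph.InducesOnCosets S false M ∧
      (∀ N : Subgroup H, (∀ i, N ≤ S i) → (∀ i, ∀ a ∈ S i, ∀ n ∈ N, a * n * a⁻¹ ∈ N) → N = ⊥) ∧
      Finite ↥(S true ⊓ S false) ∧ n ≤ Nat.card ↥(S true ⊓ S false) := by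
  obtain ⟨Δ, π, o, d₀, d₁, k, ho, hK, hLb, hd, hkL, hk1, hko, hkπ⟩ :=
    exists_blocks_of_not_isSemiprimitivePerm hL
  have : Finite Δ := Finite.of_surjective π fun d => ⟨o d, ho d⟩
  obtain ⟨m, hm1⟩ := Subgroup.ne_bot_iff_exists_ne_one.1 hM
  obtain ⟨δ₀, hδ₀⟩ : ∃ δ₀, (m : Perm Ψ) δ₀ ≠ δ₀ := by
    by_contra! h
    exact hm1 (Subtype.ext (Equiv.ext h))
  obtain ⟨D, hD⟩ := exists_positions (Q := Fin n) hMt δ₀ d₀ d₁ hd m m.2 hδ₀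
  refine ⟨_, inferInstance, D.amalgam L π o, D.inducesOnCosets_left ho hK hLb,
    D.inducesOnCosets_right, D.eq_bot_of_normalized ho hK hLb hLt hMt, inferInstance, ?_⟩
  refine le_trans ?_ (D.card_le_card_amalgam hkL hk1 hko hkπ)
  have := Nat.card_le_card_of_injective
    (fun q : Fin n => (⟨some ((δ₀, q), d₀), hD (δ₀, q)⟩ : {i // D.colour i = d₀}))
    (fun q q' h => by simpa using h)
  simpa using this

theorem theorem1p3 {Ω₁ Ω₂ V : Type*} [Finite Ω₁] [Finite Ω₂]
    (L₁ : Subgroup (Equiv.Perm Ω₁)) (L₂ : Subgroup (Equiv.Perm Ω₂))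
    (hL₁ : L₁ ≠ ⊥) (hL₂ : L₂ ≠ ⊥)
    (ht₁ : IsTransitivePerm L₁) (ht₂ : IsTransitivePerm L₂)
    (hns : ¬ IsSemiprimitivePerm L₁ ∨ ¬ IsSemiprimitivePerm L₂)
    (T : SimpleGraph V) (hT : T.IsTree) (hreg : T.IsBiregular (Nat.card Ω₁) (Nat.card Ω₂))
    (c : ℤ) :
    ∃ G : Subgroup (T ≃g T), SimpleGraph.IsLocally G L₁ L₂ ∧
      ∃ u v : V, T.Adj u v ∧
        Finite ↥(SimpleGraph.vertexStab G u ⊓ SimpleGraph.vertexStab G v) ∧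
        c ≤ Nat.card ↥(SimpleGraph.vertexStab G u ⊓ SimpleGraph.vertexStab G v) := by
  rcases hns with h | h
  · obtain ⟨H, _, S, h₁, h₂, hcore, hfin, hcard⟩ :=
      exists_amalgam_of_not_isSemiprimitivePerm h ht₁ ht₂ hL₂ c.toNat
    obtain ⟨G, hG, u, v, huv, ⟨e⟩⟩ :=
      hT.exists_isLocally_of_amalgam hreg ht₁ ht₂ h₁ h₂ hcore
    refine ⟨G, hG, u, v, huv, Finite.of_equiv _ e, ?_⟩
    rw [← Nat.card_congr e]
    exact (Int.self_le_toNat c).trans (by exact_mod_cast hcard)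
  · obtain ⟨H, _, S, h₂, h₁, hcore, hfin, hcard⟩ :=
      exists_amalgam_of_not_isSemiprimitivePerm h ht₂ ht₁ hL₁ c.toNat
    -- the two groups of the amalgam are interchanged
    obtain ⟨G, hG, u, v, huv, ⟨e⟩⟩ :=
      hT.exists_isLocally_of_amalgam (S := fun i => S (!i)) hreg ht₁ ht₂ h₁ h₂
        fun N hN hN' => hcore N (Bool.forall_bool.2 ⟨hN true, hN false⟩)
          (Bool.forall_bool.2 ⟨hN' true, hN' false⟩)
    rw [inf_comm] at hfin hcard
    have : Finite ↥(S (!true) ⊓ S (!false)) := hfin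
    refine ⟨G, hG, u, v, huv, Finite.of_equiv _ e, ?_⟩
    rw [← Nat.card_congr e]
    exact (Int.self_le_toNat c).trans (by exact_mod_cast hcard)
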